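/- Let $N$ be a positive integer, let $\Lambda=\{w\in\mathbb R^N:\ \sum_i w^i=1,\ w^i\ge 0\}$, and let $\delta_\Lambda$ be the function equal to $0$ on $\Lambda$ and $+\infty$ elsewhere. Let $F:\mathbb R^N\to\mathbb R\cup\{+\infty\}$ be a storage fee function, i.e. a proper, closed (lower semicontinuous), convex function with effective domain $\operatorname{dom}F\subset\Lambda$. Suppose that $F$ splits: $F(w)=\sum_{i=1}^N f_i(w^i)+\delta_\Lambda(w)$, where each $f_i:\mathbb R\to\mathbb R\cup\{+\infty\}$ is proper, closed and convex with $\operatorname{dom}f_i\subset[0,1]$. Suppose moreover that for every $i$: - $f_i$ is essentially smooth: $C_i=\operatorname{int}(\operatorname{dom} f_i)$ is nonempty, $f_i$ is differentiable on $C_i$, and $|f_i'(x_k)|\to+\infty$ for every sequence $(x_k)$ in $C_i$ converging to a boundary point of $C_i$; - $f_i$ is twice differentiable on $C_i$ and $f_i''$ is locally Lipschitz on $C_i$; - $f_i$ is strongly convex on $\operatorname{dom}f_i$ with a parameter $\eta>0$ that does not depend on $i$ (so that $f_i''\ge\eta$ on $C_i$). If $N\ge2$, assume also that $\operatorname{dom}F$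 is not a single point. Let $F^*(\psi)=\sup_{w\in\mathbb R^N}\big(\langle\psi,w\rangle-F(w)\big)$ be the convex conjugate of $F$. Then $F^*$ is finite and twice differentiable on all of $\mathbb R^N$, and for every $\psi\in\mathbb R^N$ $$\ker D^2F^*(\psi)=\operatorname{span}\{\mathbb 1\},$$ where $\mathbb 1\in\mathbb R^N$ is the vector all of whose components are $1$. -/

import Mathlib

open Set Filter Topology

noncomputable section

namespace StorageFee

/-- The effective domain of an extended-real-valued function: the points where it is not `+∞`. -/
def effDom {E : Type*} (g : E → EReal) : Set E := {x | g x ≠ ⊤}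

/-- The real-valued function which agrees with `g` wherever `g` is finite. -/
def realPart {E : Type*} (g : E → EReal) : E → ℝ := fun x => (g x).toReal

/-- A proper closed convex function `E → ℝ ∪ {+∞}`: it never takes the value `-∞`, it is not
identically `+∞`, it is lower semicontinuous, and its epigraph is convex. -/
structure IsProperClosedConvex {E : Type*} [AddCommGroup E] [Module ℝ E] [TopologicalSpace E]
    (g : E → EReal) : Prop where
  ne_bot : ∀ x, g x ≠ ⊥
  nonempty_effDom : (effDom g).Nonempty
  closed : LowerSemicontinuous g
  convex : Convex ℝ {p : E × ℝ | g p.1 ≤ (p.2 : EReal)}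

/-- The set of admissible weight vectors (the unit simplex of `ℝ^N`). -/
def weightSet (N : ℕ) : Set (EuclideanSpace ℝ (Fin N)) :=
  {w | ∑ i, w i = 1 ∧ ∀ i, 0 ≤ w i}

open Classical in
/-- The convex-analysis indicator function of a set: `0` on `A` and `+∞` off `A`. -/
def indicatorFn {E : Type*} (A : Set E) : E → EReal := fun x => if x ∈ A then 0 else ⊤

/-- A storage fee function: proper, closed, convex and `+∞` outside of the simplex. -/
structure IsStorageFee {N : ℕ} (F : EuclideanSpace ℝ (Fin N) → EReal) : Prop where
  properClosedConvex : IsProperClosedConvex F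
  effDom_subset : effDom F ⊆ weightSet N

/-- `F` splits into the one-variable functions `f i`. -/
structure SplitsInto {N : ℕ} (F : EuclideanSpace ℝ (Fin N) → EReal) (f : Fin N → ℝ → EReal) :
    Prop where
  properClosedConvex : ∀ i, IsProperClosedConvex (f i)
  effDom_subset : ∀ i, effDom (f i) ⊆ Icc 0 1
  eq_sum : ∀ w, F w = ∑ i, f i (w i) + indicatorFn (weightSet N) w

/-- Essential smoothness of an extended-real-valued function `g` of one real variable: with
`C = interior (dom g)`, `C` is nonempty, `g` is differentiable on `C`, and `|g'(x k)| → +∞` for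
every sequence `x k` in `C` that converges to a boundary point of `C`. -/
structure IsEssentiallySmooth (g : ℝ → EReal) : Prop where
  nonempty : (interior (effDom g)).Nonempty
  differentiableOn : DifferentiableOn ℝ (realPart g) (interior (effDom g))
  tendsto_abs_deriv : ∀ x : ℕ → ℝ, (∀ k, x k ∈ interior (effDom g)) →
    ∀ z ∈ frontier (interior (effDom g)), Tendsto x atTop (𝓝 z) →
      Tendsto (fun k => |deriv (realPart g) (x k)|) atTop atTop

/-- The Legendre-Fenchel conjugate `g*(ψ) = sup_w (⟨ψ, w⟩ - g w)`. -/
def conjugate {E : Type*} [NormedAddCommGroup E] [InnerProductSpace ℝ E] (g : E → EReal) :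
    E → EReal :=
  fun ψ => ⨆ w : E, ((inner ℝ ψ w : ℝ) : EReal) - g w

/-- The Hessian `D²h(ψ)`, as the derivative of the gradient. -/
def hessian {N : ℕ} (h : EuclideanSpace ℝ (Fin N) → ℝ) (ψ : EuclideanSpace ℝ (Fin N)) :
    EuclideanSpace ℝ (Fin N) →L[ℝ] EuclideanSpace ℝ (Fin N) :=
  fderiv ℝ (gradient h) ψ

/-- The vector of `ℝ^N` all of whose components are `1`. -/
def oneVec (N : ℕ) : EuclideanSpace ℝ (Fin N) := WithLp.toLp 2 (fun _ => (1 : ℝ))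

end StorageFee

end

/-! The supremum defining `F*` is a maximum over a simplex, with one Lagrange multiplier `μ(ψ)` for
the constraint that the weights sum to one. Strong convexity and blow-up at the endpoints make each
`f_i'` an increasing bijection from the interior of `dom f_i` onto `ℝ`, whose inverse `r_i` has
positive derivative (`exists_deriv_inverse`). For `N ≥ 2` the maximizer is therefore `w_i(ψ) =
r_i(ψ_i - μ(ψ))`, where `μ(ψ)` solves `∑ r_i(ψ_i - μ(ψ)) = 1`. Differentiating this constraint shows
that `μ` is differentiable and that `Dμ(𝟙) = 1` (`exists_hasFDerivAt_of_sum_eq`).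

The gradient of `F*` is `w` (`hasGradientAt_conjugate_of_isMax`), so the Hessian sends `v` to the
vector with entries `r_i' (v_i - Dμ(v))`. As `r_i' > 0`, this vanishes exactly when `v` is a
multiple of `𝟙` (`exists_hasFDerivAt_ker_eq_span`). -/

namespace StorageFee

/-! ### One-variable convex analysis: inverting the derivative -/

/-- The tangent-line inequality for a convex function at a point of differentiability. -/
lemma tangent_le_of_convexOn {D : Set ℝ} {φ : ℝ → ℝ} (hφ : ConvexOn ℝ D φ) {x y : ℝ}
    (hx : x ∈ D) (hy : y ∈ D) (hd : DifferentiableAt ℝ φ x) :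
    φ x + deriv φ x * (y - x) ≤ φ y := by
  rcases lt_trichotomy x y with h | rfl | h
  · have := hφ.deriv_le_slope hx hy h hd
    rw [slope_def_field, le_div_iff₀ (by linarith)] at this
    linarith
  · simp
  · have := hφ.slope_le_deriv hy hx h hd
    rw [slope_def_field, div_le_iff₀ (by linarith)] at this
    linarith

/-- The derivative of a strongly convex function is strongly monotone. -/
lemma monotoneOn_deriv_sub_mul_of_strongConvexOn {D : Set ℝ} {φ : ℝ → ℝ} {η : ℝ}
    (hφ : StrongConvexOn D η φ) (hd : DifferentiableOn ℝ φ (interior D)) :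
    MonotoneOn (fun x => deriv φ x - η * x) (interior D) := by
  have hda : ∀ x ∈ interior D, DifferentiableAt ℝ φ x := fun x hx =>
    hd.differentiableAt (isOpen_interior.mem_nhds hx)
  have hc := (strongConvexOn_iff_convex.1 hφ).subset interior_subset hφ.1.interior
  have hder : ∀ x ∈ interior D,
      HasDerivAt (fun x => φ x - η / 2 * ‖x‖ ^ 2) (deriv φ x - η * x) x := by
    intro x hx
    have h2 : HasDerivAt (fun x : ℝ => η / 2 * ‖x‖ ^ 2) (η * x) x := by
      simp only [Real.norm_eq_abs, sq_abs]
      refine ((hasDerivAt_pow 2 x).const_mul (η / 2)).congr_deriv ?_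
      push_cast
      ring
    exact (hda x hx).hasDerivAt.sub h2
  intro x hx y hy hxy
  have := hc.monotoneOn_deriv (fun z hz => (hder z hz).differentiableAt) hx hy hxy
  rwa [(hder x hx).deriv, (hder y hy).deriv] at this

/-- A bounded convex set of reals with nonempty interior lies between two consecutive points. -/
lemma exists_interior_eq_Ioo {D : Set ℝ} (hD : Convex ℝ D) (hne : (interior D).Nonempty)
    (hb : D ⊆ Icc 0 1) : ∃ a b : ℝ, a < b ∧ interior D = Ioo a b ∧ D ⊆ Icc a b := by
  have hconn : IsConnected (interior D) := ⟨hne, hD.interior.isPreconnected⟩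
  have hbb : BddBelow (interior D) := bddBelow_Icc.mono (interior_subset.trans hb)
  have hba : BddAbove (interior D) := bddAbove_Icc.mono (interior_subset.trans hb)
  have hsub : interior D ⊆ Icc (sInf (interior D)) (sSup (interior D)) :=
    subset_Icc_csInf_csSup hbb hba
  have heq : interior D = Ioo (sInf (interior D)) (sSup (interior D)) := by
    refine Subset.antisymm ?_ (hconn.Ioo_csInf_csSup_subset hbb hba)
    calc interior D = interior (interior D) := interior_interior.symm
      _ ⊆ interior (Icc _ _) := interior_mono hsub
      _ = _ := interior_Icc
  refine ⟨_, _, ?_, heq, ?_⟩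
  · obtain ⟨x, hx⟩ := hne
    rw [heq] at hx
    exact hx.1.trans hx.2
  -- A convex set with nonempty interior has the same closure as its interior.
  · calc D ⊆ closure D := subset_closure
      _ = closure (interior D) := (hD.closure_interior_eq_closure_of_nonempty_interior hne).symm
      _ ⊆ closure (Icc _ _) := closure_mono hsub
      _ = _ := isClosed_Icc.closure_eq

/-- Otherwise, along a sequence decreasing to `a`, monotonicity traps `u` between `t` and its first
value, contradicting blow-up. This excludes `u → +∞` at the left endpoint, which the condition on
`|u|` alone allows. -/
lemma exists_lt_of_blowup_left {a b : ℝ} (hab : a < b) {u : ℝ → ℝ} (hu : MonotoneOn u (Ioo a b))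
    (hblow : ∀ x : ℕ → ℝ, (∀ k, x k ∈ Ioo a b) → Tendsto x atTop (𝓝 a) →
      Tendsto (fun k => |u (x k)|) atTop atTop) (t : ℝ) : ∃ x ∈ Ioo a b, u x < t := by
  by_contra! hcon
  obtain ⟨x, hanti, hx, hlim⟩ := exists_seq_strictAnti_tendsto' hab
  have := hblow x hx hlim
  obtain ⟨k, hk⟩ := (this.eventually_gt_atTop (max |t| |u (x 0)|)).exists
  refine absurd hk (not_lt.2 ?_)
  have h1 := hcon _ (hx k)
  have h2 := hu (hx k) (hx 0) (hanti.antitone (Nat.zero_le k))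
  exact abs_le_max_abs_abs h1 h2

lemma exists_gt_of_blowup_right {a b : ℝ} (hab : a < b) {u : ℝ → ℝ} (hu : MonotoneOn u (Ioo a b))
    (hblow : ∀ x : ℕ → ℝ, (∀ k, x k ∈ Ioo a b) → Tendsto x atTop (𝓝 b) →
      Tendsto (fun k => |u (x k)|) atTop atTop) (t : ℝ) : ∃ x ∈ Ioo a b, t < u x := by
  by_contra! hcon
  obtain ⟨x, hmono, hx, hlim⟩ := exists_seq_strictMono_tendsto' hab
  have := hblow x hx hlim
  obtain ⟨k, hk⟩ := (this.eventually_gt_atTop (max |u (x 0)| |t|)).exists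
  refine absurd hk (not_lt.2 ?_)
  have h1 := hcon _ (hx k)
  have h2 := hu (hx 0) (hx k) (hmono.monotone (Nat.zero_le k))
  exact abs_le_max_abs_abs h2 h1

/-- For an essentially smooth strongly convex function of one variable, the derivative is a
bijection from the interior of the domain onto `ℝ`, with a differentiable increasing inverse. -/
lemma exists_deriv_inverse {g : ℝ → EReal} (hb : effDom g ⊆ Icc 0 1)
    (hs : IsEssentiallySmooth g)
    (ht : DifferentiableOn ℝ (deriv (realPart g)) (interior (effDom g)))
    {η : ℝ} (hη : 0 < η) (hg : StrongConvexOn (effDom g) η (realPart g)) :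
    ∃ (a b : ℝ) (r : ℝ → ℝ), a < b ∧ Ioo a b ⊆ effDom g ∧ effDom g ⊆ Icc a b ∧
      (∀ t, r t ∈ Ioo a b) ∧ (∀ x ∈ Ioo a b, ∃ t, r t = x) ∧ StrictMono r ∧
      (∀ t, ∃ d > 0, HasDerivAt r d t) ∧
      ∀ t, ∀ y ∈ effDom g, realPart g (r t) + t * (y - r t) ≤ realPart g y := by
  obtain ⟨a, b, hab, hint, hsub⟩ := exists_interior_eq_Ioo hg.1 hs.nonempty hb
  have hsm := monotoneOn_deriv_sub_mul_of_strongConvexOn hg hs.differentiableOn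
  have hd := hs.differentiableOn
  have hblow := hs.tendsto_abs_deriv
  have hIoo : Ioo a b ⊆ effDom g := hint ▸ interior_subset
  rw [hint] at hsm hd ht hblow
  rw [frontier_Ioo hab] at hblow
  set u := deriv (realPart g) with hu
  have hstrict : StrictMonoOn u (Ioo a b) := by
    intro x hx y hy hxy
    have := hsm hx hy hxy.le
    simp only at this
    nlinarith
  have hsurj : ∀ t, ∃ x ∈ Ioo a b, u x = t := by
    intro t
    obtain ⟨x, hx, hxt⟩ := exists_lt_of_blowup_left hab hstrict.monotoneOn
      (fun x hx hl => hblow x hx a (by simp) hl) t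
    obtain ⟨y, hy, hyt⟩ := exists_gt_of_blowup_right hab hstrict.monotoneOn
      (fun x hx hl => hblow x hx b (by simp) hl) t
    obtain ⟨z, hz, hzt⟩ := isPreconnected_Ioo.intermediate_value hx hy ht.continuousOn
      ⟨hxt.le, hyt.le⟩
    exact ⟨z, hz, hzt⟩
  choose r hr hur using hsurj
  have hru : ∀ x ∈ Ioo a b, r (u x) = x := fun x hx => hstrict.injOn (hr _) hx (hur _)
  have hmono : StrictMono r := fun s t hst => by
    rwa [← hstrict.lt_iff_lt (hr s) (hr t), hur, hur]
  -- Strong monotonicity of `u` at `r t ≤ r s` reads `η (r s - r t) ≤ s - t`, whence the constant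
  -- `η⁻¹`.
  have hcont : Continuous r := by
    refine LipschitzWith.continuous (K := NNReal.mk η⁻¹ (inv_pos.2 hη).le)
      (LipschitzWith.of_le_add_mul _ fun s t => ?_)
    rw [NNReal.coe_mk, ← sub_le_iff_le_add']
    rcases le_total (r s) (r t) with hst | hst
    · exact (sub_nonpos.2 hst).trans (mul_nonneg (inv_pos.2 hη).le dist_nonneg)
    · have h1 := hsm (hr t) (hr s) hst
      simp only [hur] at h1
      have h2 := le_abs_self (s - t)
      rw [inv_mul_eq_div, le_div_iff₀ hη, Real.dist_eq]
      linarith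
  refine ⟨a, b, r, hab, hIoo, hsub, hr, fun x hx => ⟨u x, hru x hx⟩, hmono, fun t => ?_,
    fun t y hy => ?_⟩
  · have hnhds : Ioo a b ∈ 𝓝 (r t) := isOpen_Ioo.mem_nhds (hr t)
    have hdu : HasDerivAt u (deriv u (r t)) (r t) := (ht.differentiableAt hnhds).hasDerivAt
    have hpos : η ≤ deriv u (r t) := by
      have h1 : HasDerivAt (fun x => u x - η * x) (deriv u (r t) - η * 1) (r t) :=
        hdu.sub ((hasDerivAt_id _).const_mul η)
      have h2 := hsm.derivWithin_nonneg (x := r t)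
      rw [derivWithin_of_mem_nhds hnhds, h1.deriv] at h2
      linarith
    exact ⟨(deriv u (r t))⁻¹, inv_pos.2 (hη.trans_le hpos), hdu.of_local_left_inverse
      hcont.continuousAt (hη.trans_le hpos).ne' (Eventually.of_forall hur)⟩
  · have := tangent_le_of_convexOn (hg.strictConvexOn hη).convexOn (hIoo (hr t)) hy
      (hd.differentiableAt (isOpen_Ioo.mem_nhds (hr t)))
    rwa [← hu, hur] at this

/-! ### The Lagrange multiplier and its derivative -/

/-- If `μ φ - μ ψ` exceeded `‖φ - ψ‖`, every argument `φ i - μ φ` would lie below `ψ i - μ ψ`, and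
strict monotonicity would separate two sums that both equal `c`. -/
lemma abs_sub_le_norm_of_sum_eq {N : ℕ} (hN : 0 < N) {r : Fin N → ℝ → ℝ}
    (hr : ∀ i, StrictMono (r i)) {μ : EuclideanSpace ℝ (Fin N) → ℝ} {c : ℝ}
    (hμ : ∀ ψ, ∑ i, r i (ψ i - μ ψ) = c) (φ ψ : EuclideanSpace ℝ (Fin N)) :
    |μ φ - μ ψ| ≤ ‖φ - ψ‖ := by
  have key : ∀ φ ψ, μ φ - μ ψ ≤ ‖φ - ψ‖ := by
    intro φ ψ
    by_contra! h
    have : ∑ i, r i (φ i - μ φ) < ∑ i, r i (ψ i - μ ψ) := by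
      refine Finset.sum_lt_sum_of_nonempty ⟨⟨0, hN⟩, Finset.mem_univ _⟩ fun i _ => hr i ?_
      have h1 := PiLp.norm_apply_le (φ - ψ) i
      have h2 := le_abs_self (φ i - ψ i)
      simp only [PiLp.sub_apply, Real.norm_eq_abs] at h1
      linarith
    rw [hμ, hμ] at this
    exact this.false
  refine abs_sub_le_iff.2 ⟨key φ ψ, ?_⟩
  rw [norm_sub_rev]
  exact key ψ φ

/-- The Lagrange multiplier, defined implicitly by a sum constraint, is differentiable. -/
lemma exists_hasFDerivAt_of_sum_eq {N : ℕ} (hN : 0 < N) {r : Fin N → ℝ → ℝ}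
    (hr : ∀ i, StrictMono (r i)) (hd : ∀ i t, ∃ d > 0, HasDerivAt (r i) d t)
    {μ : EuclideanSpace ℝ (Fin N) → ℝ} {c : ℝ}
    (hμ : ∀ ψ, ∑ i, r i (ψ i - μ ψ) = c) (ψ : EuclideanSpace ℝ (Fin N)) :
    ∃ L : EuclideanSpace ℝ (Fin N) →L[ℝ] ℝ, HasFDerivAt μ L ψ ∧ L (oneVec N) = 1 := by
  have hlip := abs_sub_le_norm_of_sum_eq hN hr hμ
  choose d hdpos hd using fun i => hd i (ψ i - μ ψ)
  have hD : 0 < ∑ i, d i :=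
    Finset.sum_pos (fun i _ => hdpos i) ⟨⟨0, hN⟩, Finset.mem_univ _⟩
  -- Formally differentiating the constraint gives `∑ d i (v i - L v) = 0`, so `L` is the
  -- `d`-weighted average of the coordinates.
  refine ⟨(∑ i, d i)⁻¹ • ∑ i, d i • EuclideanSpace.proj i, ?_, ?_⟩
  · have hO : ∀ i, (fun φ : EuclideanSpace ℝ (Fin N) => (φ i - μ φ) - (ψ i - μ ψ))
        =O[𝓝 ψ] fun φ => φ - ψ := by
      intro i
      refine Asymptotics.IsBigO.of_bound 2 (Eventually.of_forall fun φ => ?_)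
      have h1 := PiLp.norm_apply_le (φ - ψ) i
      have h2 := hlip φ ψ
      simp only [PiLp.sub_apply, Real.norm_eq_abs] at h1 ⊢
      have := abs_sub (φ i - ψ i) (μ φ - μ ψ)
      rw [show φ i - μ φ - (ψ i - μ ψ) = φ i - ψ i - (μ φ - μ ψ) by ring]
      linarith
    have hcont : ContinuousAt μ ψ := by
      rw [Metric.continuousAt_iff]
      intro ε hε
      refine ⟨ε, hε, fun {φ} hφ => ?_⟩
      rw [Real.dist_eq]
      rw [dist_eq_norm] at hφ
      exact (hlip φ ψ).trans_lt hφ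
    have ho : ∀ i, (fun φ : EuclideanSpace ℝ (Fin N) =>
        r i (φ i - μ φ) - r i (ψ i - μ ψ) - ((φ i - μ φ) - (ψ i - μ ψ)) * d i)
        =o[𝓝 ψ] fun φ => φ - ψ := by
      intro i
      have ht : Tendsto (fun φ : EuclideanSpace ℝ (Fin N) => φ i - μ φ) (𝓝 ψ)
          (𝓝 (ψ i - μ ψ)) :=
        ((EuclideanSpace.proj (𝕜 := ℝ) i).continuous.continuousAt.sub hcont)
      exact ((hasDerivAt_iff_isLittleO.1 (hd i)).comp_tendsto ht).trans_isBigO (hO i)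
    have hsum := Asymptotics.IsLittleO.fun_sum (s := Finset.univ) fun i _ => ho i
    rw [hasFDerivAt_iff_isLittleO]
    refine (hsum.const_mul_left (∑ i, d i)⁻¹).congr_left fun φ => ?_
    have h1 := hμ φ
    have h2 := hμ ψ
    -- Both constraint sums equal `c`, so the `r i` terms cancel and the summed first-order
    -- remainders are exactly `∑ d i` times the remainder of `μ`.
    have h3 : ∑ i, (r i (φ i - μ φ) - r i (ψ i - μ ψ) - ((φ i - μ φ) - (ψ i - μ ψ)) * d i)
        = (∑ i, d i) * (μ φ - μ ψ) - ∑ i, d i * (φ i - ψ i) := by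
      rw [Finset.sum_sub_distrib, Finset.sum_sub_distrib, h1, h2, sub_self, zero_sub,
        Finset.sum_mul, ← Finset.sum_sub_distrib, ← Finset.sum_neg_distrib]
      exact Finset.sum_congr rfl fun i _ => by ring
    rw [h3, mul_sub, inv_mul_cancel_left₀ hD.ne']
    simp
  · simp [oneVec, hD.ne']

/-- Coordinatewise strictly increasing functions of `ψ - μ(ψ) 𝟙`, with `μ` determined by a sum
constraint, form a differentiable map whose derivative has kernel spanned by `𝟙`. -/
lemma exists_hasFDerivAt_ker_eq_span {N : ℕ} (hN : 0 < N) {r : Fin N → ℝ → ℝ}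
    (hr : ∀ i, StrictMono (r i)) (hd : ∀ i t, ∃ d > 0, HasDerivAt (r i) d t)
    {μ : EuclideanSpace ℝ (Fin N) → ℝ} {c : ℝ}
    (hμ : ∀ ψ, ∑ i, r i (ψ i - μ ψ) = c) (ψ : EuclideanSpace ℝ (Fin N)) :
    ∃ A : EuclideanSpace ℝ (Fin N) →L[ℝ] EuclideanSpace ℝ (Fin N),
      HasFDerivAt (fun φ : EuclideanSpace ℝ (Fin N) =>
        (WithLp.toLp 2 fun i => r i (φ i - μ φ) : EuclideanSpace ℝ (Fin N))) A ψ ∧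
      A.toLinearMap.ker = Submodule.span ℝ {oneVec N} := by
  obtain ⟨L, hL, hL1⟩ := exists_hasFDerivAt_of_sum_eq hN hr hd hμ ψ
  choose d hdpos hd using fun i => hd i (ψ i - μ ψ)
  have hcoord : ∀ i, HasFDerivAt (fun φ : EuclideanSpace ℝ (Fin N) => r i (φ i - μ φ))
      (d i • (EuclideanSpace.proj i - L)) ψ := fun i =>
    (hd i).comp_hasFDerivAt ψ ((EuclideanSpace.proj (𝕜 := ℝ) i).hasFDerivAt.sub hL)
  refine ⟨((EuclideanSpace.equiv (Fin N) ℝ).symm :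
      (Fin N → ℝ) →L[ℝ] EuclideanSpace ℝ (Fin N)).comp
    (ContinuousLinearMap.pi fun i => d i • (EuclideanSpace.proj i - L)), ?_, ?_⟩
  · exact ((EuclideanSpace.equiv (Fin N) ℝ).symm :
      (Fin N → ℝ) →L[ℝ] EuclideanSpace ℝ (Fin N)).hasFDerivAt.comp ψ
      (hasFDerivAt_pi.2 hcoord)
  · ext v
    rw [LinearMap.mem_ker, Submodule.mem_span_singleton]
    have hv : ∀ i, (((EuclideanSpace.equiv (Fin N) ℝ).symm :
      (Fin N → ℝ) →L[ℝ] EuclideanSpace ℝ (Fin N)).comp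
        (ContinuousLinearMap.pi fun i => d i • (EuclideanSpace.proj i - L))) v i
        = d i * (v i - L v) := fun i => rfl
    constructor
    · intro h
      refine ⟨L v, ?_⟩
      ext i
      have h1 := hv i
      rw [ContinuousLinearMap.coe_coe] at h
      rw [h] at h1
      have h2 := (mul_eq_zero.1 h1.symm).resolve_left (hdpos i).ne'
      simp only [oneVec, PiLp.smul_apply, smul_eq_mul, mul_one]
      linarith
    · rintro ⟨s, rfl⟩
      ext i
      rw [ContinuousLinearMap.coe_coe, hv, map_smul, hL1]
      simp [oneVec]

/-! ### Maximizers and the gradient of the conjugate -/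

/-- If the supremum defining the conjugate of `F` is attained at `w ψ` for all `ψ`, then the
conjugate is the corresponding real value. -/
lemma conjugate_eq_coe_of_isMax {E : Type*} [NormedAddCommGroup E] [InnerProductSpace ℝ E]
    {F : E → EReal} (hbot : ∀ x, F x ≠ ⊥) {ψ w : E} (hw : w ∈ effDom F)
    (hmax : ∀ y ∈ effDom F, realPart F w + inner ℝ ψ (y - w) ≤ realPart F y) :
    conjugate F ψ = ((inner ℝ ψ w - realPart F w : ℝ) : EReal) := by
  have hcoe : ∀ y ∈ effDom F, F y = (realPart F y : EReal) := fun y hy =>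
    (EReal.coe_toReal hy (hbot y)).symm
  refine le_antisymm (iSup_le fun y => ?_) ?_
  · by_cases hy : F y = ⊤
    · simp [hy]
    · rw [hcoe y hy, ← EReal.coe_sub, EReal.coe_le_coe_iff]
      have := hmax y hy
      rw [inner_sub_right] at this
      linarith
  · refine le_iSup_of_le w ?_
    rw [hcoe w hw, EReal.coe_sub]

/-- A continuous selection of maximizers is the gradient of the conjugate. -/
lemma hasGradientAt_conjugate_of_isMax {E : Type*} [NormedAddCommGroup E] [InnerProductSpace ℝ E]
    [CompleteSpace E] {F : E → EReal} (hbot : ∀ x, F x ≠ ⊥) {w : E → E} (hcont : Continuous w)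
    (hw : ∀ ψ, w ψ ∈ effDom F)
    (hmax : ∀ ψ, ∀ y ∈ effDom F, realPart F (w ψ) + inner ℝ ψ (y - w ψ) ≤ realPart F y) (ψ : E) :
    HasGradientAt (realPart (conjugate F)) (w ψ) ψ := by
  have hval : ∀ φ, realPart (conjugate F) φ = inner ℝ φ (w φ) - realPart F (w φ) := fun φ => by
    rw [realPart, conjugate_eq_coe_of_isMax hbot (hw φ) (hmax φ), EReal.toReal_coe]
  rw [hasGradientAt_iff_hasFDerivAt, hasFDerivAt_iff_isLittleO, Asymptotics.isLittleO_iff]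
  intro c hc
  filter_upwards [hcont.continuousAt.eventually (Metric.ball_mem_nhds (w ψ) hc)] with φ hφ
  rw [dist_eq_norm] at hφ
  -- Testing each maximizer against the other point's problem squeezes the remainder `F*(φ) - F*(ψ)
  -- - ⟨w ψ, φ - ψ⟩` between `0` and `⟨φ - ψ, w φ - w ψ⟩`.
  have h1 := hmax φ (w ψ) (hw ψ)
  have h2 := hmax ψ (w φ) (hw φ)
  have h3 := real_inner_le_norm (φ - ψ) (w φ - w ψ)
  have h4 : ‖φ - ψ‖ * ‖w φ - w ψ‖ ≤ c * ‖φ - ψ‖ := by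
    rw [mul_comm]; exact mul_le_mul_of_nonneg_right hφ.le (norm_nonneg _)
  rw [hval, hval, InnerProductSpace.toDual_apply_apply, Real.norm_eq_abs, abs_le]
  simp only [inner_sub_left, inner_sub_right, real_inner_comm (w ψ)] at *
  have h5 := mul_nonneg hc.le (norm_nonneg (φ - ψ))
  constructor <;> linarith

/-! ### Effective domain and finite values of a splitting function -/

variable {N : ℕ} {F : EuclideanSpace ℝ (Fin N) → EReal} {f : Fin N → ℝ → EReal}

lemma sum_eq_coe {ι : Type*} (s : Finset ι) {x : ι → EReal} (ht : ∀ i, x i ≠ ⊤)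
    (hb : ∀ i, x i ≠ ⊥) : ∑ i ∈ s, x i = ((∑ i ∈ s, (x i).toReal : ℝ) : EReal) := by
  classical
  induction s using Finset.induction_on with
  | empty => simp
  | insert a s ha ih =>
    rw [Finset.sum_insert ha, Finset.sum_insert ha, ih, EReal.coe_add,
      EReal.coe_toReal (ht a) (hb a)]

lemma sum_ne_bot {ι : Type*} (s : Finset ι) {x : ι → EReal} (hb : ∀ i, x i ≠ ⊥) :
    ∑ i ∈ s, x i ≠ ⊥ := by
  classical
  induction s using Finset.induction_on with
  | empty => simp
  | insert a s ha ih =>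
    rw [Finset.sum_insert ha, Ne, EReal.add_eq_bot_iff, not_or]
    exact ⟨hb a, ih⟩

lemma SplitsInto.mem_effDom_iff (h : SplitsInto F f) (w : EuclideanSpace ℝ (Fin N)) :
    w ∈ effDom F ↔ w ∈ weightSet N ∧ ∀ i, w i ∈ effDom (f i) := by
  -- In `EReal`, `⊤ + ⊥ = ⊥`, so an infinite summand forces the sum to be `⊤` only once `⊥` is
  -- excluded.
  have hb : ∀ i, f i (w i) ≠ ⊥ := fun i => (h.properClosedConvex i).ne_bot _
  constructor
  · intro hw
    have hw' : ∑ i, f i (w i) + indicatorFn (weightSet N) w ≠ ⊤ := h.eq_sum w ▸ hw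
    have hmem : w ∈ weightSet N := by
      by_contra hcon
      rw [indicatorFn, if_neg hcon] at hw'
      exact hw' (EReal.add_top_of_ne_bot (sum_ne_bot _ hb))
    refine ⟨hmem, fun i hi => hw' ?_⟩
    rw [indicatorFn, if_pos hmem, add_zero, ← Finset.add_sum_erase _ _ (Finset.mem_univ i), hi]
    exact EReal.top_add_of_ne_bot (sum_ne_bot _ hb)
  · rintro ⟨hmem, hi⟩
    change F w ≠ ⊤
    rw [h.eq_sum, indicatorFn, if_pos hmem, add_zero, sum_eq_coe _ hi hb]
    exact EReal.coe_ne_top _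

lemma SplitsInto.realPart_eq (h : SplitsInto F f) {w : EuclideanSpace ℝ (Fin N)}
    (hw : w ∈ effDom F) : realPart F w = ∑ i, realPart (f i) (w i) := by
  obtain ⟨hmem, hi⟩ := (h.mem_effDom_iff w).1 hw
  rw [realPart, h.eq_sum, indicatorFn, if_pos hmem, add_zero,
    sum_eq_coe _ hi fun i => (h.properClosedConvex i).ne_bot _, EReal.toReal_coe]
  rfl

/-! ### Feasibility of the constraint -/

/-- Existence of the Lagrange multiplier for a feasible sum constraint. -/
lemma exists_sum_sub_eq {N : ℕ} {r : Fin N → ℝ → ℝ} (hr : ∀ i, Monotone (r i))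
    (hc : ∀ i, Continuous (r i)) (s ψ : Fin N → ℝ) :
    ∃ m : ℝ, ∑ i, r i (ψ i - m) = ∑ i, r i (s i) := by
  have hle : ∀ i, |ψ i - s i| ≤ ∑ j, |ψ j - s j| := fun i =>
    Finset.single_le_sum (f := fun j => |ψ j - s j|) (fun j _ => abs_nonneg _) (Finset.mem_univ i)
  -- Intermediate values: shifting by `±∑ |ψ j - s j|` puts every argument below, respectively
  -- above, `s i`.
  refine mem_range_of_exists_le_of_exists_ge
    (continuous_finsetSum _ fun i _ => (hc i).comp (continuous_const.sub continuous_id))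
    ⟨∑ j, |ψ j - s j|, Finset.sum_le_sum fun i _ => hr i ?_⟩
    ⟨-∑ j, |ψ j - s j|, Finset.sum_le_sum fun i _ => hr i ?_⟩
  · have := (le_abs_self _).trans (hle i)
    linarith
  · have := (neg_abs_le _).trans' (neg_le_neg (hle i))
    linarith

/-- If a box contains two distinct points whose coordinates sum to `1`, its interior contains
a point whose coordinates sum to `1`. -/
lemma exists_sum_eq_one_mem_Ioo {N : ℕ} {a b : Fin N → ℝ} (hab : ∀ i, a i < b i)
    {u v : Fin N → ℝ} (hu : ∀ i, u i ∈ Icc (a i) (b i)) (hv : ∀ i, v i ∈ Icc (a i) (b i))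
    (hu1 : ∑ i, u i = 1) (hv1 : ∑ i, v i = 1) (huv : u ≠ v) :
    ∃ p : Fin N → ℝ, (∀ i, p i ∈ Ioo (a i) (b i)) ∧ ∑ i, p i = 1 := by
  -- Equality would force both `u` and `v` to be the corner `a`; likewise with `b` for the upper
  -- bound.
  have hA : ∑ i, a i < 1 := by
    refine lt_of_le_of_ne (hu1 ▸ Finset.sum_le_sum fun i _ => (hu i).1) fun h => huv ?_
    have h1 := (Finset.sum_eq_sum_iff_of_le fun i _ => (hu i).1).1 (h.trans hu1.symm)
    have h2 := (Finset.sum_eq_sum_iff_of_le fun i _ => (hv i).1).1 (h.trans hv1.symm)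
    exact funext fun i => (h1 i (Finset.mem_univ i)).symm.trans (h2 i (Finset.mem_univ i))
  have hB : 1 < ∑ i, b i := by
    refine lt_of_le_of_ne (hu1 ▸ Finset.sum_le_sum fun i _ => (hu i).2) fun h => huv ?_
    have h1 := (Finset.sum_eq_sum_iff_of_le fun i _ => (hu i).2).1 (hu1.trans h)
    have h2 := (Finset.sum_eq_sum_iff_of_le fun i _ => (hv i).2).1 (hv1.trans h)
    exact funext fun i => (h1 i (Finset.mem_univ i)).trans (h2 i (Finset.mem_univ i)).symm
  set A := ∑ i, a i
  set B := ∑ i, b i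
  have hBA : 0 < B - A := by linarith
  have ht0 : 0 < (1 - A) / (B - A) := div_pos (by linarith) hBA
  have ht1 : (1 - A) / (B - A) < 1 := (div_lt_one hBA).2 (by linarith)
  -- The point where the diagonal from `a` to `b` meets the hyperplane of coordinate sum `1`.
  refine ⟨fun i => a i + (1 - A) / (B - A) * (b i - a i), fun i => ⟨?_, ?_⟩, ?_⟩
  · have := mul_pos ht0 (sub_pos.2 (hab i))
    linarith
  · have := mul_lt_mul_of_pos_right ht1 (sub_pos.2 (hab i))
    linarith
  · rw [Finset.sum_add_distrib, ← Finset.mul_sum, Finset.sum_sub_distrib,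
      div_mul_cancel₀ _ hBA.ne']
    ring

lemma eq_oneVec_of_mem_weightSet_one {w : EuclideanSpace ℝ (Fin 1)} (hw : w ∈ weightSet 1) :
    w = oneVec 1 := by
  ext i
  have := hw.1
  rw [Fin.sum_univ_one] at this
  rw [Subsingleton.elim i 0, this]
  rfl

lemma span_oneVec_one : Submodule.span ℝ {oneVec 1} = ⊤ := by
  refine eq_top_iff.2 fun v _ => Submodule.mem_span_singleton.2 ⟨v 0, ?_⟩
  ext i
  rw [Subsingleton.elim i 0]
  simp [oneVec]

/-! ### Construction of the maximizer -/

/-- The maximizers in the definition of the conjugate of a splitting storage fee function form a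
differentiable map, and the kernel of its derivative is spanned by `𝟙`. -/
lemma exists_maximizer_hasFDerivAt {N : ℕ} {F : EuclideanSpace ℝ (Fin N) → EReal}
    {f : Fin N → ℝ → EReal} (hF : IsStorageFee F) (hsplit : SplitsInto F f)
    (hsmooth : ∀ i, IsEssentiallySmooth (f i))
    (htwice : ∀ i, DifferentiableOn ℝ (deriv (realPart (f i))) (interior (effDom (f i))))
    {η : ℝ} (hη : 0 < η) (hstrong : ∀ i, StrongConvexOn (effDom (f i)) η (realPart (f i)))
    (hpoint : 2 ≤ N → ¬ ∃ a, effDom F = {a}) :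
    ∃ w : EuclideanSpace ℝ (Fin N) → EuclideanSpace ℝ (Fin N),
      (∀ ψ, w ψ ∈ effDom F) ∧
      (∀ ψ, ∀ y ∈ effDom F, realPart F (w ψ) + inner ℝ ψ (y - w ψ) ≤ realPart F y) ∧
      ∀ ψ, ∃ A : EuclideanSpace ℝ (Fin N) →L[ℝ] EuclideanSpace ℝ (Fin N),
        HasFDerivAt w A ψ ∧ A.toLinearMap.ker = Submodule.span ℝ {oneVec N} := by
  obtain ⟨u, hu⟩ := hF.properClosedConvex.nonempty_effDom
  have hN : 0 < N := by
    rcases Nat.eq_zero_or_pos N with rfl | h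
    · have := (hF.effDom_subset hu).1
      simp at this
    · exact h
  rcases Nat.lt_or_ge N 2 with h2 | h2
  -- The simplex is a single point here: `w` is constant, and the kernel of its zero derivative is
  -- the whole line, which `𝟙` spans.
  · obtain rfl : N = 1 := by omega
    refine ⟨fun _ => u, fun _ => hu, fun ψ y hy => ?_, fun ψ => ⟨0, hasFDerivAt_const u ψ, ?_⟩⟩
    · rw [eq_oneVec_of_mem_weightSet_one (hF.effDom_subset hu),
        eq_oneVec_of_mem_weightSet_one (hF.effDom_subset hy)]
      simp
    · rw [span_oneVec_one]
      exact LinearMap.ker_zero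
  obtain ⟨v, hv, huv⟩ : ∃ v ∈ effDom F, u ≠ v := by
    by_contra! hcon
    exact hpoint h2 ⟨u, Subset.antisymm (fun v hv => (hcon v hv).symm) (singleton_subset_iff.2 hu)⟩
  choose a b r hab hsub hsub' hrmem hsurj hmono hderiv htan using fun i =>
    exists_deriv_inverse (hsplit.effDom_subset i) (hsmooth i) (htwice i) hη (hstrong i)
  have hu' := (hsplit.mem_effDom_iff u).1 hu
  have hv' := (hsplit.mem_effDom_iff v).1 hv
  obtain ⟨p, hp, hp1⟩ := exists_sum_eq_one_mem_Ioo hab (fun i => hsub' i (hu'.2 i))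
    (fun i => hsub' i (hv'.2 i)) hu'.1.1 hv'.1.1 fun h => huv (PiLp.ext fun i => congrFun h i)
  choose s hs using fun i => hsurj i (p i) (hp i)
  have hcont : ∀ i, Continuous (r i) := fun i => continuous_iff_continuousAt.2 fun t => by
    obtain ⟨d, -, hd⟩ := hderiv i t
    exact hd.continuousAt
  choose μ hμ using fun ψ : EuclideanSpace ℝ (Fin N) =>
    exists_sum_sub_eq (fun i => (hmono i).monotone) hcont s ψ
  -- Since `r i (s i) = p i` and `p` has coordinate sum `1`, the constraint solved by `μ ψ` has
  -- right-hand side `1`.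
  simp only [hs, hp1] at hμ
  have hmem : ∀ ψ, (WithLp.toLp 2 fun i => r i (ψ i - μ ψ) : EuclideanSpace ℝ (Fin N))
      ∈ effDom F := fun ψ => (hsplit.mem_effDom_iff _).2
    ⟨⟨hμ ψ, fun i => (hsplit.effDom_subset i (hsub i (hrmem i _))).1⟩,
      fun i => hsub i (hrmem i _)⟩
  refine ⟨fun ψ => WithLp.toLp 2 fun i => r i (ψ i - μ ψ), hmem, fun ψ y hy => ?_,
    exists_hasFDerivAt_ker_eq_span hN hmono hderiv hμ⟩
  have hy' := (hsplit.mem_effDom_iff y).1 hy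
  rw [hsplit.realPart_eq (hmem ψ), hsplit.realPart_eq hy]
  have hsum := Finset.sum_le_sum fun i (_ : i ∈ Finset.univ) =>
    htan i (ψ i - μ ψ) (y i) (hy'.2 i)
  rw [Finset.sum_add_distrib] at hsum
  refine le_trans (le_of_eq ?_) hsum
  congr 1
  -- Both points have coordinate sum `1`, so replacing `ψ` by `ψ - μ(ψ) 𝟙` does not change the
  -- pairing with their difference; summing the tangent-line inequalities then proves maximality.
  have h0 : ∑ i, (y i - r i (ψ i - μ ψ)) = 0 := by
    rw [Finset.sum_sub_distrib, hμ, hy'.1.1, sub_self]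
  calc inner ℝ ψ (y - WithLp.toLp 2 fun i => r i (ψ i - μ ψ))
      = ∑ i, ψ i * (y i - r i (ψ i - μ ψ)) := by
        rw [PiLp.inner_apply]
        exact Finset.sum_congr rfl fun i _ => mul_comm _ _
    _ = ∑ i, ψ i * (y i - r i (ψ i - μ ψ)) - μ ψ * ∑ i, (y i - r i (ψ i - μ ψ)) := by
        rw [h0, mul_zero, sub_zero]
    _ = ∑ i, (ψ i - μ ψ) * (y i - r i (ψ i - μ ψ)) := by
        rw [Finset.mul_sum, ← Finset.sum_sub_distrib]
        exact Finset.sum_congr rfl fun i _ => by ring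

end StorageFee

theorem mainTheorem10 {N : ℕ} (F : EuclideanSpace ℝ (Fin N) → EReal) (f : Fin N → ℝ → EReal)
    (hF : StorageFee.IsStorageFee F) (hsplit : StorageFee.SplitsInto F f)
    (hsmooth : ∀ i, StorageFee.IsEssentiallySmooth (f i))
    (htwice : ∀ i, DifferentiableOn ℝ (deriv (StorageFee.realPart (f i)))
      (interior (StorageFee.effDom (f i))))
    (hlip : ∀ i, LocallyLipschitzOn (interior (StorageFee.effDom (f i)))
      (deriv (deriv (StorageFee.realPart (f i)))))
    (η : ℝ) (hη : 0 < η)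
    (hstrong : ∀ i, StrongConvexOn (StorageFee.effDom (f i)) η (StorageFee.realPart (f i)))
    (hpoint : 2 ≤ N → ¬ ∃ a, StorageFee.effDom F = {a}) :
    (∀ ψ, StorageFee.conjugate F ψ ≠ ⊥ ∧ StorageFee.conjugate F ψ ≠ ⊤) ∧
    Differentiable ℝ (StorageFee.realPart (StorageFee.conjugate F)) ∧
    Differentiable ℝ (gradient (StorageFee.realPart (StorageFee.conjugate F))) ∧
    ∀ ψ : EuclideanSpace ℝ (Fin N),
      (StorageFee.hessian (StorageFee.realPart (StorageFee.conjugate F)) ψ).toLinearMap.ker =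
        Submodule.span ℝ {StorageFee.oneVec N} := by
  obtain ⟨w, hw, hmax, hder⟩ := StorageFee.exists_maximizer_hasFDerivAt hF hsplit hsmooth htwice hη
    hstrong hpoint
  have hbot := hF.properClosedConvex.ne_bot
  have hcont : Continuous w := continuous_iff_continuousAt.2 fun ψ => by
    obtain ⟨A, hA, -⟩ := hder ψ
    exact hA.continuousAt
  have hgrad := StorageFee.hasGradientAt_conjugate_of_isMax hbot hcont hw hmax
  have hgw : gradient (StorageFee.realPart (StorageFee.conjugate F)) = w :=
    funext fun ψ => (hgrad ψ).gradient
  refine ⟨fun ψ => ?_, fun ψ => (hgrad ψ).differentiableAt, fun ψ => ?_, fun ψ => ?_⟩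
  · rw [StorageFee.conjugate_eq_coe_of_isMax hbot (hw ψ) (hmax ψ)]
    exact ⟨EReal.coe_ne_bot _, EReal.coe_ne_top _⟩
  · obtain ⟨A, hA, -⟩ := hder ψ
    rw [hgw]
    exact hA.differentiableAt
  · obtain ⟨A, hA, hker⟩ := hder ψ
    rw [StorageFee.hessian, hgw, hA.fderiv]
    exact hker
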